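/- Let $\mathbb{K}$ be a field of characteristic zero and $\mathcal{H}=\bigoplus_{n\ge 0}\mathcal{H}_n$ a connected graded Hopf algebra over $\mathbb{K}$ (so $\mathcal{H}_0=\mathbb{K}1$). Let $A=\mathrm{Hom}(\mathcal{H},\mathbb{K})$ with the convolution product $\star$, filtered by $A_n=\{f : f|_{\mathcal{H}_i}=0 \text{ for all } i<n\}$; $A$ is complete for this filtration. Let $\mathfrak{g}\subset A_1$ be the Lie algebra of infinitesimal characters, i.e. of the $f\in A$ with $f(ab)=\varepsilon(a)f(b)+f(a)\varepsilon(b)$. Let $\pi_-:A\to A$ be precomposition with the projector of $\mathcal{H}$ onto its part of odd degree, and $\pi_+=\mathrm{id}_A-\pi_-$. For $x,y\in A_1$ put $$\mathrm{BCH}(x,y)=\log\big(\exp(x)\star\exp(y)\big)-x-y ,$$ where $\exp$ and $\log$ are the usual power series, convergent in the topology of the filtration. For $Z\in A_1$ define the BCH-recursion by $\chi_{(0)}(Z)=Z$, $\chi_{(n+1)}(Z)=Z-\mathrm{BCH}\big(\pi_-(\chi_{(n)}(Z)),\pi_+(\chi_{(n)}(Z))\big)$ and $\chi(Z)=\lim_{n\to\infty}\chi_{(n)}(Z)$.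 Then for every $Z\in\mathfrak{g}$ this limit exists in the topology of the filtration, and $$\chi(Z)=Z+\mathrm{BCH}\Big(-\pi_-(Z)-\tfrac12\,\mathrm{BCH}\big(Z,\,2\pi_-(Z)-Z\big),\,Z\Big).$$ Moreover, its odd part is $$\pi_-(\chi(Z))=\pi_-(Z)+\tfrac12\,\mathrm{BCH}\big(Z,\,\pi_-(Z)-\pi_+(Z)\big).$$ -/

import Mathlib

open scoped TensorProduct

namespace EvenOddBCH

section

variable {K H : Type*} [Field K] [Ring H] [HopfAlgebra K H]

/-- A grading `𝒜` of the algebra `H` makes `H` a connected graded Hopf algebra: the coproduct and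
the counit are homogeneous of degree `0` and the degree `0` part is `K · 1`. (The antipode is then
automatically homogeneous.) -/
structure IsConnectedGradedHopf (𝒜 : ℕ → Submodule K H) [GradedAlgebra 𝒜] : Prop where
  comul_mem : ∀ n, ∀ h ∈ 𝒜 n, Coalgebra.comul (R := K) h ∈
    ⨆ p ∈ Finset.HasAntidiagonal.antidiagonal n, LinearMap.range (TensorProduct.mapIncl (𝒜 p.1) (𝒜 p.2))
  counit_eq_zero : ∀ n, n ≠ 0 → ∀ h ∈ 𝒜 n, Coalgebra.counit (R := K) h = 0
  connected : 𝒜 0 = Submodule.span K {(1 : H)}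

variable (K H) in
/-- The algebra `Hom(H, K)` with the convolution product `f ⋆ g = m ∘ (f ⊗ g) ∘ Δ`. Its unit is the
counit of `H`. -/
abbrev Conv : Type _ := WithConv (H →ₗ[K] K)

variable (K H) in
/-- The Lie algebra `𝔤` of infinitesimal characters (derivations `H → K` along the counit). -/
def infinitesimalCharacters : Submodule K (Conv K H) where
  carrier := {f | ∀ a b : H, f (a * b) =
    Coalgebra.counit (R := K) a * f b + f a * Coalgebra.counit (R := K) b}
  zero_mem' := by intro a b; simp
  add_mem' := by
    intro f g hf hg a b
    simp only [WithConv.ofConv_add, LinearMap.add_apply, hf a b, hg a b]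
    ring
  smul_mem' := by
    intro c f hf a b
    simp only [WithConv.ofConv_smul, LinearMap.smul_apply, hf a b, smul_eq_mul]
    ring

/-- The decreasing filtration `A_n` of `A = Hom(H, K)`: the functionals that vanish in all degrees
`< n`. -/
def filt (𝒜 : ℕ → Submodule K H) (n : ℕ) : Submodule K (Conv K H) where
  carrier := {f | ∀ i < n, ∀ h ∈ 𝒜 i, f h = 0}
  zero_mem' := by intro i _ h _; simp
  add_mem' := by
    intro f g hf hg i hi h hh
    simp [hf i hi h hh, hg i hi h hh]
  smul_mem' := by
    intro c f hf i hi h hh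
    simp [hf i hi h hh]

/-- Convergence of sequences in `Hom(H, K)` for the topology given by the filtration. -/
def FiltTendsto (𝒜 : ℕ → Submodule K H) (u : ℕ → Conv K H) (f : Conv K H) : Prop :=
  ∀ N, ∀ᶠ n in Filter.atTop, u n - f ∈ filt 𝒜 N

open Classical in
/-- The limit of a sequence for the topology given by the filtration (`0` if there is none). -/
noncomputable def filtLim (𝒜 : ℕ → Submodule K H) (u : ℕ → Conv K H) : Conv K H :=
  if h : ∃ f, FiltTendsto 𝒜 u f then h.choose else 0

/-- `exp a = ∑ aⁿ / n!`, for `a ∈ A_1`. -/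
noncomputable def exp (𝒜 : ℕ → Submodule K H) (a : Conv K H) : Conv K H :=
  filtLim 𝒜 fun N => ∑ n ∈ Finset.range N, ((n.factorial : K)⁻¹) • a ^ n

/-- `log (1 + a) = ∑_{n ≥ 1} (-1)ⁿ⁺¹ aⁿ / n`, for `a ∈ A_1`; the argument here is `1 + a`. -/
noncomputable def log (𝒜 : ℕ → Submodule K H) (b : Conv K H) : Conv K H :=
  filtLim 𝒜 fun N => ∑ n ∈ Finset.Ico 1 N, ((-1) ^ (n + 1) / (n : K)) • (b - 1) ^ n

/-- `BCH(x, y)`, the Baker-Campbell-Hausdorff series without its linear terms, so that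
`exp x ⋆ exp y = exp (x + y + BCH(x, y))`. -/
noncomputable def BCH (𝒜 : ℕ → Submodule K H) (x y : Conv K H) : Conv K H :=
  log 𝒜 (exp 𝒜 x * exp 𝒜 y) - x - y

/-- The iterates of the BCH-recursion for a linear map `P` on `A`:
`χ₀(a) = a` and `χₙ₊₁(a) = a - BCH(P(χₙ(a)), (id - P)(χₙ(a)))`. -/
noncomputable def chiSeq (𝒜 : ℕ → Submodule K H) (P : Conv K H →ₗ[K] Conv K H) (a : Conv K H) :
    ℕ → Conv K H
  | 0 => a
  | n + 1 => a - BCH 𝒜 (P (chiSeq 𝒜 P a n)) (chiSeq 𝒜 P a n - P (chiSeq 𝒜 P a n))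

/-- The BCH-recursion map `χ(a) = lim χₙ(a)`. -/
noncomputable def chi (𝒜 : ℕ → Submodule K H) (P : Conv K H →ₗ[K] Conv K H) (a : Conv K H) :
    Conv K H :=
  filtLim 𝒜 (chiSeq 𝒜 P a)

/-- The projector of `H` onto its part of odd degree. -/
noncomputable def oddProj (𝒜 : ℕ → Submodule K H) [GradedAlgebra 𝒜] : H →ₗ[K] H :=
  (DirectSum.toModule K ℕ H fun n => if Odd n then (𝒜 n).subtype else 0) ∘ₗ
    (DirectSum.decomposeLinearEquiv 𝒜).toLinearMap

/-- The projector `π₋` lifted to `Hom(H, K)` by precomposition. -/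
noncomputable def piMinus (𝒜 : ℕ → Submodule K H) [GradedAlgebra 𝒜] :
    Conv K H →ₗ[K] Conv K H where
  toFun f := WithConv.toConv (f.ofConv ∘ₗ oddProj 𝒜)
  map_add' f g := by ext; simp
  map_smul' c f := by ext; simp

/-- The complementary projector `π₊ = id - π₋` on `Hom(H, K)`. -/
noncomputable def piPlus (𝒜 : ℕ → Submodule K H) [GradedAlgebra 𝒜] :
    Conv K H →ₗ[K] Conv K H :=
  LinearMap.id - piMinus 𝒜

/-! Basic facts: `A` is a complete filtered algebra, `𝔤 ⊆ A_1`, limits are unique, and the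
series that define `exp` and `log` converge. -/

section Facts

variable (𝒜 : ℕ → Submodule K H)

theorem filt_anti {m n : ℕ} (hmn : m ≤ n) : filt 𝒜 n ≤ filt 𝒜 m :=
  fun _ hf i hi h hh => hf i (lt_of_lt_of_le hi hmn) h hh

variable [GradedAlgebra 𝒜]

theorem oddProj_apply {n : ℕ} {h : H} (hh : h ∈ 𝒜 n) :
    oddProj 𝒜 h = if Odd n then h else 0 := by
  simp only [oddProj, LinearMap.comp_apply, LinearEquiv.coe_coe,
    DirectSum.decomposeLinearEquiv_apply]
  rw [DirectSum.decompose_of_mem 𝒜 hh]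
  erw [DirectSum.toModule_lof]
  split_ifs <;> simp

theorem infinitesimalCharacters_le (h𝒜 : IsConnectedGradedHopf 𝒜) :
    infinitesimalCharacters K H ≤ filt 𝒜 1 := by
  intro f hf i hi h hh
  obtain rfl : i = 0 := by omega
  rw [h𝒜.connected, Submodule.mem_span_singleton] at hh
  obtain ⟨c, rfl⟩ := hh
  have h1 : f (1 : H) = 0 := by simpa using hf 1 1
  simp [h1]

theorem mul_mem_filt (h𝒜 : IsConnectedGradedHopf 𝒜) {m n : ℕ} {f g : Conv K H}
    (hf : f ∈ filt 𝒜 m) (hg : g ∈ filt 𝒜 n) : f * g ∈ filt 𝒜 (m + n) := by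
  intro i hi h hh
  rw [LinearMap.convMul_apply]
  have key : (⨆ p ∈ Finset.HasAntidiagonal.antidiagonal i,
      LinearMap.range (TensorProduct.mapIncl (𝒜 p.1) (𝒜 p.2))) ≤
      LinearMap.ker (LinearMap.mul' K K ∘ₗ TensorProduct.map f.ofConv g.ofConv) := by
    refine iSup₂_le fun p hp => ?_
    rw [TensorProduct.range_mapIncl, Submodule.map₂_le]
    intro a ha b hb
    have hp' := Finset.HasAntidiagonal.mem_antidiagonal.mp hp
    simp only [LinearMap.mem_ker, LinearMap.comp_apply, TensorProduct.mk_apply,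
      TensorProduct.map_tmul, LinearMap.mul'_apply]
    rcases lt_or_ge p.1 m with h1 | h1
    · rw [hf p.1 h1 a ha, zero_mul]
    · rw [hg p.2 (by omega) b hb, mul_zero]
  exact key (h𝒜.comul_mem i h hh)

theorem pow_mem_filt (h𝒜 : IsConnectedGradedHopf 𝒜) {a : Conv K H} (ha : a ∈ filt 𝒜 1) (n : ℕ) :
    a ^ n ∈ filt 𝒜 n := by
  induction n with
  | zero => intro i hi; omega
  | succ n ih => rw [pow_succ]; exact mul_mem_filt 𝒜 h𝒜 ih ha

theorem filtTendsto_unique {u : ℕ → Conv K H} {f g : Conv K H}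
    (hf : FiltTendsto 𝒜 u f) (hg : FiltTendsto 𝒜 u g) : f = g := by
  have h0 : ∀ i, ∀ h ∈ 𝒜 i, f h = g h := by
    intro i h hh
    obtain ⟨n, h1, h2⟩ := ((hf (i + 1)).and (hg (i + 1))).exists
    have e1 := h1 i (Nat.lt_succ_self i) h hh
    have e2 := h2 i (Nat.lt_succ_self i) h hh
    simp only [WithConv.ofConv_sub, LinearMap.sub_apply, sub_eq_zero] at e1 e2
    rw [← e1, ← e2]
  ext h
  induction h using DirectSum.Decomposition.inductionOn 𝒜 with
  | zero => simp
  | homogeneous m => exact h0 _ _ m.2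
  | add a b ha hb => rw [map_add, map_add, ha, hb]

theorem filtLim_eq {u : ℕ → Conv K H} {f : Conv K H} (hf : FiltTendsto 𝒜 u f) :
    filtLim 𝒜 u = f := by
  have hex : ∃ f, FiltTendsto 𝒜 u f := ⟨f, hf⟩
  rw [filtLim, dif_pos hex]
  exact filtTendsto_unique 𝒜 hex.choose_spec hf

/-- Completeness for the filtration. -/
theorem filtTendsto_filtLim {u : ℕ → Conv K H} (hu : ∀ n, u (n + 1) - u n ∈ filt 𝒜 n) :
    FiltTendsto 𝒜 u (filtLim 𝒜 u) := by
  have stab : ∀ i, ∀ h ∈ 𝒜 i, ∀ n, i + 1 ≤ n → u n h = u (i + 1) h := by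
    intro i h hh n hn
    induction n, hn using Nat.le_induction with
    | base => rfl
    | succ n hn ih =>
      have e := hu n i (by omega) h hh
      simp only [WithConv.ofConv_sub, LinearMap.sub_apply, sub_eq_zero] at e
      rw [e, ih]
  let f : Conv K H := WithConv.toConv
    ((DirectSum.toModule K ℕ K fun i => (u (i + 1)).ofConv ∘ₗ (𝒜 i).subtype) ∘ₗ
      (DirectSum.decomposeLinearEquiv 𝒜).toLinearMap)
  have hf : ∀ i, ∀ h ∈ 𝒜 i, f h = u (i + 1) h := by
    intro i h hh
    simp only [f, LinearMap.comp_apply, LinearEquiv.coe_coe,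
      DirectSum.decomposeLinearEquiv_apply]
    rw [DirectSum.decompose_of_mem 𝒜 hh]
    erw [DirectSum.toModule_lof]
    rfl
  have hlim : FiltTendsto 𝒜 u f := by
    intro N
    filter_upwards [Filter.eventually_ge_atTop N] with n hn i hi h hh
    simp only [WithConv.ofConv_sub, LinearMap.sub_apply]
    rw [hf i h hh, stab i h hh n (by omega), sub_self]
  rw [filtLim_eq 𝒜 hlim]
  exact hlim

theorem filtTendsto_exp (h𝒜 : IsConnectedGradedHopf 𝒜) {a : Conv K H} (ha : a ∈ filt 𝒜 1) :
    FiltTendsto 𝒜 (fun N => ∑ n ∈ Finset.range N, ((n.factorial : K)⁻¹) • a ^ n) (exp 𝒜 a) := by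
  refine filtTendsto_filtLim 𝒜 fun n => ?_
  rw [Finset.sum_range_succ, add_sub_cancel_left]
  exact Submodule.smul_mem _ _ (pow_mem_filt 𝒜 h𝒜 ha n)

theorem filtTendsto_log (h𝒜 : IsConnectedGradedHopf 𝒜) {b : Conv K H} (hb : b - 1 ∈ filt 𝒜 1) :
    FiltTendsto 𝒜 (fun N => ∑ n ∈ Finset.Ico 1 N, ((-1) ^ (n + 1) / (n : K)) • (b - 1) ^ n)
      (log 𝒜 b) := by
  refine filtTendsto_filtLim 𝒜 fun n => ?_
  rcases Nat.eq_zero_or_pos n with rfl | hn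
  · intro i hi; omega
  · rw [Finset.sum_Ico_succ_top (by omega), add_sub_cancel_left]
    exact Submodule.smul_mem _ _ (pow_mem_filt 𝒜 h𝒜 hb n)

end Facts

end

end EvenOddBCH

/-! Write c = χ(Z), c₋ = π₋(c), c₊ = c - c₋. On `A_1` the map `BCH` gains one degree of the
filtration on differences (`BCH_sub_BCH_mem`), so the recursion is a contraction. It converges to a
solution of c = Z - BCH(c₋, c₊), which says exp(c₋) ⋆ exp(c₊) = exp(Z) (`exp_mul_exp_chi`).

Since Δ is homogeneous, σ = π₊ - π₋ is an algebra endomorphism of `A` (`gradeSign_mul`). Applied to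
the factorization it gives exp(-c₋) ⋆ exp(c₊) = exp(σZ). Eliminating exp(c₊) leaves exp(Z) ⋆
exp(-σZ) = exp(2c₋), and its logarithm is the formula for the odd part. Then exp(c₊) = exp(-c₋) ⋆
exp(Z) yields c in terms of c₋.

The identities between exp and log are transported from `K⟦X⟧` by evaluating power series at
elements of `A_1`, an algebra homomorphism compatible with substitution. -/

namespace EvenOddBCH

/-! ### Formal exp and log as compositional inverses. -/

section PowerSeriesIdentities

open PowerSeries

variable (K : Type*) [Field K] [CharZero K]

theorem one_add_X_mul_deriv_log :
    (1 + X : K⟦X⟧) * PowerSeries.derivative K (PowerSeries.log K) = 1 := by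
  rw [deriv_log]
  ext n
  rcases n with _ | n
  · simp [add_mul]
  · simp [add_mul, coeff_succ_X_mul, pow_succ]

/-- By the chain rule and (1 + X) log' = 1, both sides have derivative 1; both have zero constant
term. -/
theorem log_subst_exp_sub_one :
    (PowerSeries.log K).subst (PowerSeries.exp K - 1) = (X : K⟦X⟧) := by
  have hE : HasSubst (PowerSeries.exp K - 1) := HasSubst.exp_sub_one
  refine derivative.ext ?_ ?_
  · have h := congrArg (substAlgHom hE) (one_add_X_mul_deriv_log K)
    rw [map_mul, map_add, map_one, coe_substAlgHom, subst_X hE, add_sub_cancel] at h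
    rw [derivative_subst hE, map_sub, derivative_exp, Derivation.map_one_eq_zero, sub_zero,
      mul_comm, h, derivative_X]
  · rw [constantCoeff_X]
    exact constantCoeff_subst_eq_zero (by simp [← constantCoeff_eq]) _ constantCoeff_log

/-- exp - 1 has a right compositional inverse because its linear coefficient is a unit; the left
inverse log must equal it. -/
theorem exp_sub_one_subst_log :
    (PowerSeries.exp K - 1).subst (PowerSeries.log K) = (X : K⟦X⟧) := by
  have hu : IsUnit (coeff 1 (PowerSeries.exp K - 1)) := by simp [coeff_exp, coeff_one]
  have hc : constantCoeff (PowerSeries.exp K - 1) = 0 := by simp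
  have hr := subst_substInvOfIsUnit_right _ hc hu
  have hs := HasSubst.substInvOfIsUnit _ hu
  have : PowerSeries.log K = substInvOfIsUnit (PowerSeries.exp K - 1) hu := by
    have h := subst_comp_subst_apply (HasSubst.exp_sub_one (A := K)) hs (PowerSeries.log K)
    rw [hr, X_subst, log_subst_exp_sub_one, subst_X hs] at h
    exact h.symm
  rw [this, hr]

end PowerSeriesIdentities

/-! ### Evaluation of power series on `A_1`. -/

section Evaluation

variable {K H : Type*} [Field K] [Ring H] [HopfAlgebra K H]
variable (𝒜 : ℕ → Submodule K H) [GradedAlgebra 𝒜]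

theorem ext_homogeneous {f g : Conv K H} (h : ∀ i, ∀ a ∈ 𝒜 i, f a = g a) : f = g := by
  refine filtTendsto_unique 𝒜 (u := fun _ => f) (fun N => ?_) (fun N => ?_)
  · simp
  · refine Filter.Eventually.of_forall fun _ i _ a ha => ?_
    simp [h i a ha]

theorem eq_of_forall_sub_mem_filt {f g : Conv K H} (h : ∀ N, f - g ∈ filt 𝒜 N) : f = g := by
  refine ext_homogeneous 𝒜 fun i a ha => ?_
  simpa [sub_eq_zero] using h (i + 1) i (Nat.lt_succ_self i) a ha

omit [GradedAlgebra 𝒜] in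
theorem mem_filt_zero (f : Conv K H) : f ∈ filt 𝒜 0 := fun _ hi => absurd hi (Nat.not_lt_zero _)

variable {𝒜}

omit [GradedAlgebra 𝒜] in
theorem FiltTendsto.const_sub {u : ℕ → Conv K H} {f : Conv K H} (hf : FiltTendsto 𝒜 u f)
    {N m : ℕ} (hu : ∀ n, m ≤ n → u n - u m ∈ filt 𝒜 N) : f - u m ∈ filt 𝒜 N := by
  obtain ⟨n, h1, h2⟩ := ((hf N).and (Filter.eventually_ge_atTop m)).exists
  have := Submodule.sub_mem _ (hu n h2) h1
  rwa [show u n - u m - (u n - f) = f - u m by abel] at this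

variable (h𝒜 : IsConnectedGradedHopf 𝒜)
include h𝒜

theorem mul_left_mem_filt {n : ℕ} (f : Conv K H) {g : Conv K H} (hg : g ∈ filt 𝒜 n) :
    f * g ∈ filt 𝒜 n := by
  simpa using mul_mem_filt 𝒜 h𝒜 (mem_filt_zero 𝒜 f) hg

theorem mul_right_mem_filt {n : ℕ} {f : Conv K H} (hf : f ∈ filt 𝒜 n) (g : Conv K H) :
    f * g ∈ filt 𝒜 n := by
  simpa using mul_mem_filt 𝒜 h𝒜 hf (mem_filt_zero 𝒜 g)

theorem aeval_mem_filt {a : Conv K H} (ha : a ∈ filt 𝒜 1) {p : Polynomial K} {N : ℕ}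
    (hp : Polynomial.X ^ N ∣ p) : Polynomial.aeval a p ∈ filt 𝒜 N := by
  obtain ⟨q, rfl⟩ := hp
  rw [map_mul, map_pow, Polynomial.aeval_X]
  exact mul_right_mem_filt h𝒜 (pow_mem_filt 𝒜 h𝒜 ha N) _

omit h𝒜 in
variable (𝒜) in
/-- The value `∑ fₙ aⁿ` of a power series `f` at an element `a` of `A_1`. -/
noncomputable def evalSeries (a : Conv K H) (f : PowerSeries K) : Conv K H :=
  filtLim 𝒜 fun N => Polynomial.aeval a (f.trunc N)

theorem aeval_trunc_sub_mem_filt {a : Conv K H} (ha : a ∈ filt 𝒜 1) (f : PowerSeries K)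
    {m n : ℕ} (hmn : m ≤ n) :
    Polynomial.aeval a (f.trunc n) - Polynomial.aeval a (f.trunc m) ∈ filt 𝒜 m := by
  rw [← map_sub]
  refine aeval_mem_filt h𝒜 ha (Polynomial.X_pow_dvd_iff.2 fun d hd => ?_)
  simp [PowerSeries.coeff_trunc, hd, hd.trans_le hmn]

theorem filtTendsto_evalSeries {a : Conv K H} (ha : a ∈ filt 𝒜 1) (f : PowerSeries K) :
    FiltTendsto 𝒜 (fun N => Polynomial.aeval a (f.trunc N)) (evalSeries 𝒜 a f) :=
  filtTendsto_filtLim 𝒜 fun n => aeval_trunc_sub_mem_filt h𝒜 ha f n.le_succ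

theorem evalSeries_sub_aeval_mem {a : Conv K H} (ha : a ∈ filt 𝒜 1) (f : PowerSeries K) (N : ℕ) :
    evalSeries 𝒜 a f - Polynomial.aeval a (f.trunc N) ∈ filt 𝒜 N :=
  (filtTendsto_evalSeries h𝒜 ha f).const_sub fun _ hn => aeval_trunc_sub_mem_filt h𝒜 ha f hn

theorem evalSeries_mem_filt {a : Conv K H} (ha : a ∈ filt 𝒜 1) {f : PowerSeries K} {N : ℕ}
    (hf : PowerSeries.X ^ N ∣ f) : evalSeries 𝒜 a f ∈ filt 𝒜 N := by
  have h := evalSeries_sub_aeval_mem h𝒜 ha f N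
  have h0 : f.trunc N = 0 := by
    ext d
    rw [PowerSeries.coeff_trunc]
    split_ifs with hd
    · simpa using PowerSeries.X_pow_dvd_iff.1 hf d hd
    · simp
  simpa [h0] using h

omit h𝒜 in
theorem evalSeries_coe (a : Conv K H) (p : Polynomial K) :
    evalSeries 𝒜 a p = Polynomial.aeval a p := by
  refine filtLim_eq 𝒜 fun N => ?_
  filter_upwards [Filter.eventually_gt_atTop p.natDegree] with n hn
  simp [PowerSeries.trunc_coe_eq_self hn]

theorem evalSeries_add {a : Conv K H} (ha : a ∈ filt 𝒜 1) (f g : PowerSeries K) :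
    evalSeries 𝒜 a (f + g) = evalSeries 𝒜 a f + evalSeries 𝒜 a g := by
  refine filtLim_eq 𝒜 fun N => ?_
  filter_upwards [filtTendsto_evalSeries h𝒜 ha f N, filtTendsto_evalSeries h𝒜 ha g N]
    with n hf hg
  rw [map_add, map_add, add_sub_add_comm]
  exact Submodule.add_mem _ hf hg

theorem evalSeries_mul {a : Conv K H} (ha : a ∈ filt 𝒜 1) (f g : PowerSeries K) :
    evalSeries 𝒜 a (f * g) = evalSeries 𝒜 a f * evalSeries 𝒜 a g := by
  refine eq_of_forall_sub_mem_filt 𝒜 fun N => ?_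
  have hfg := evalSeries_sub_aeval_mem h𝒜 ha (f * g) N
  have hf := evalSeries_sub_aeval_mem h𝒜 ha f N
  have hg := evalSeries_sub_aeval_mem h𝒜 ha g N
  have hp : Polynomial.aeval a ((f * g).trunc N - f.trunc N * g.trunc N) ∈ filt 𝒜 N := by
    refine aeval_mem_filt h𝒜 ha (Polynomial.X_pow_dvd_iff.2 fun d hd => ?_)
    rw [Polynomial.coeff_sub, PowerSeries.coeff_trunc, if_pos hd,
      PowerSeries.coeff_mul_eq_coeff_trunc_mul_trunc f g hd, sub_eq_zero, ← Polynomial.coeff_coe,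
      Polynomial.coe_mul]
  rw [map_sub, map_mul (Polynomial.aeval a)] at hp
  set x := evalSeries 𝒜 a f
  set y := evalSeries 𝒜 a g
  set p := Polynomial.aeval a (f.trunc N)
  set q := Polynomial.aeval a (g.trunc N)
  -- Uses xy - pq = (x - p)y + p(y - q).
  have := Submodule.sub_mem _ (Submodule.add_mem _ hfg hp)
    (Submodule.add_mem _ (mul_right_mem_filt h𝒜 hf y) (mul_left_mem_filt h𝒜 p hg))
  convert this using 1
  simp only [sub_mul, mul_sub]
  abel

/-- Evaluation of power series at an element of `A_1`, as a homomorphism of algebras. -/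
noncomputable def evalSeriesHom {a : Conv K H} (ha : a ∈ filt 𝒜 1) :
    PowerSeries K →ₐ[K] Conv K H where
  toFun := evalSeries 𝒜 a
  map_one' := by simpa using evalSeries_coe (𝒜 := 𝒜) a 1
  map_mul' := evalSeries_mul h𝒜 ha
  map_zero' := by simpa using evalSeries_coe (𝒜 := 𝒜) a 0
  map_add' := evalSeries_add h𝒜 ha
  commutes' c := by simpa using evalSeries_coe (𝒜 := 𝒜) a (Polynomial.C c)

omit h𝒜 in
variable (𝒜) in
theorem evalSeries_X (a : Conv K H) : evalSeries 𝒜 a PowerSeries.X = a := by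
  simpa using evalSeries_coe (𝒜 := 𝒜) a Polynomial.X

/-- Modulo `A_N` only the truncation of f matters, since the remainder is a multiple of X ^ N; for a
polynomial f, evaluation is an algebra homomorphism. -/
theorem evalSeries_subst {a : Conv K H} (ha : a ∈ filt 𝒜 1) (f : PowerSeries K)
    {g : PowerSeries K} (hg : g.constantCoeff = 0) :
    evalSeries 𝒜 (evalSeries 𝒜 a g) f = evalSeries 𝒜 a (f.subst g) := by
  have hb : evalSeries 𝒜 a g ∈ filt 𝒜 1 :=
    evalSeries_mem_filt h𝒜 ha (by rwa [pow_one, PowerSeries.X_dvd_iff])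
  have hs : PowerSeries.HasSubst g := PowerSeries.HasSubst.of_constantCoeff_zero' hg
  refine eq_of_forall_sub_mem_filt 𝒜 fun N => ?_
  have h1 := evalSeries_sub_aeval_mem h𝒜 hb f N
  have h2 : evalSeries 𝒜 a ((f - (f.trunc N : PowerSeries K)).subst g) ∈ filt 𝒜 N := by
    refine evalSeries_mem_filt h𝒜 ha ?_
    have hd : PowerSeries.X ^ N ∣ f - (f.trunc N : PowerSeries K) := by
      refine PowerSeries.X_pow_dvd_iff.2 fun d hd => ?_
      simp [PowerSeries.coeff_trunc, hd]
    obtain ⟨q, hq⟩ := hd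
    rw [hq, PowerSeries.subst_mul hs, PowerSeries.subst_pow hs, PowerSeries.subst_X hs]
    exact (pow_dvd_pow_of_dvd (PowerSeries.X_dvd_iff.2 hg) N).mul_right _
  have h3 : Polynomial.aeval (evalSeries 𝒜 a g) (f.trunc N) =
      evalSeries 𝒜 a ((f.trunc N : PowerSeries K).subst g) := by
    rw [PowerSeries.subst_coe hs]
    exact (Polynomial.aeval_algHom_apply (evalSeriesHom h𝒜 ha) g (f.trunc N))
  have h4 : evalSeries 𝒜 a ((f - (f.trunc N : PowerSeries K)).subst g) =
      evalSeries 𝒜 a (f.subst g) - evalSeries 𝒜 a ((f.trunc N : PowerSeries K).subst g) := by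
    rw [PowerSeries.subst_sub hs]
    exact map_sub (evalSeriesHom h𝒜 ha) _ _
  rw [h4] at h2
  rw [h3] at h1
  simpa using Submodule.sub_mem _ h1 h2

theorem evalSeries_rescale {a : Conv K H} (ha : a ∈ filt 𝒜 1) (c : K) (f : PowerSeries K) :
    evalSeries 𝒜 a (PowerSeries.rescale c f) = evalSeries 𝒜 (c • a) f := by
  refine filtLim_eq 𝒜 ?_
  convert filtTendsto_evalSeries h𝒜 (Submodule.smul_mem _ c ha) f using 2 with N
  simp only [Polynomial.aeval_def, PowerSeries.eval₂_trunc_eq_sum_range]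
  refine Finset.sum_congr rfl fun n _ => ?_
  rw [PowerSeries.coeff_rescale, ← Algebra.smul_def, ← Algebra.smul_def, smul_pow, smul_smul,
    mul_comm]

theorem pow_sub_pow_mem_filt {a b : Conv K H} (ha : a ∈ filt 𝒜 1) (hb : b ∈ filt 𝒜 1) {n : ℕ}
    (hab : a - b ∈ filt 𝒜 n) (k : ℕ) : a ^ (k + 1) - b ^ (k + 1) ∈ filt 𝒜 (n + k) := by
  induction k with
  | zero => simpa using hab
  | succ k ih =>
    have h1 := mul_mem_filt 𝒜 h𝒜 hab (pow_mem_filt 𝒜 h𝒜 ha (k + 1))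
    have h2 := mul_mem_filt 𝒜 h𝒜 hb ih
    rw [show 1 + (n + k) = n + (k + 1) by ring] at h2
    convert Submodule.add_mem _ h1 h2 using 1
    rw [pow_succ' a (k + 1), pow_succ' b (k + 1)]
    simp only [sub_mul, mul_sub]
    abel

/-- First-order Taylor estimate: constant terms cancel, and in degree at least 2 each telescoped
term carries a further factor from `A_1`. -/
theorem evalSeries_sub_evalSeries_mem {a b : Conv K H} (ha : a ∈ filt 𝒜 1) (hb : b ∈ filt 𝒜 1)
    {n : ℕ} (hab : a - b ∈ filt 𝒜 n) (f : PowerSeries K) :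
    evalSeries 𝒜 a f - evalSeries 𝒜 b f - f.coeff 1 • (a - b) ∈ filt 𝒜 (n + 1) := by
  -- Truncating at n + 2 keeps the linear term even when n = 0.
  have h1 := filt_anti 𝒜 (by omega : n + 1 ≤ n + 2) (evalSeries_sub_aeval_mem h𝒜 ha f (n + 2))
  have h2 := filt_anti 𝒜 (by omega : n + 1 ≤ n + 2) (evalSeries_sub_aeval_mem h𝒜 hb f (n + 2))
  have h3 : Polynomial.aeval a (f.trunc (n + 2)) - Polynomial.aeval b (f.trunc (n + 2)) -
      f.coeff 1 • (a - b) ∈ filt 𝒜 (n + 1) := by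
    simp only [Polynomial.aeval_def, PowerSeries.eval₂_trunc_eq_sum_range, ← Algebra.smul_def]
    rw [← Finset.sum_sub_distrib, Finset.sum_range_succ', Finset.sum_range_succ']
    simp only [zero_add, pow_one, pow_zero, sub_self, add_zero, ← smul_sub, add_sub_cancel_right]
    refine Submodule.sum_mem _ fun k _ => Submodule.smul_mem _ _ ?_
    exact filt_anti 𝒜 (by omega) (pow_sub_pow_mem_filt h𝒜 ha hb hab (k + 1))
  convert Submodule.add_mem _ (Submodule.sub_mem _ h1 h2) h3 using 1
  abel

end Evaluation

/-! ### Exponential, logarithm and BCH on `A_1`. -/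

section ExpLog

variable {K H : Type*} [Field K] [CharZero K] [Ring H] [HopfAlgebra K H]
variable (𝒜 : ℕ → Submodule K H) [GradedAlgebra 𝒜]

omit [GradedAlgebra 𝒜] in
theorem exp_eq_evalSeries (a : Conv K H) : exp 𝒜 a = evalSeries 𝒜 a (PowerSeries.exp K) := by
  refine congrArg (filtLim 𝒜) (funext fun N => ?_)
  rw [Polynomial.aeval_def, PowerSeries.eval₂_trunc_eq_sum_range]
  refine Finset.sum_congr rfl fun n _ => ?_
  rw [← Algebra.smul_def, PowerSeries.coeff_exp]
  simp

omit [GradedAlgebra 𝒜] in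
theorem log_eq_evalSeries (b : Conv K H) :
    log 𝒜 b = evalSeries 𝒜 (b - 1) (PowerSeries.log K) := by
  refine congrArg (filtLim 𝒜) (funext fun N => ?_)
  rw [Polynomial.aeval_def, PowerSeries.eval₂_trunc_eq_sum_range]
  refine Finset.sum_subset_zero_on_sdiff (fun n hn => ?_) (fun n hn => ?_) fun n hn => ?_
  · exact Finset.mem_range.2 (Finset.mem_Ico.1 hn).2
  · obtain rfl : n = 0 := by
      simp only [Finset.mem_sdiff, Finset.mem_range, Finset.mem_Ico] at hn
      omega
    simp
  · have hn0 : n ≠ 0 := by have := (Finset.mem_Ico.1 hn).1; omega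
    rw [← Algebra.smul_def, PowerSeries.coeff_log, if_neg hn0]
    simp

variable {𝒜} (h𝒜 : IsConnectedGradedHopf 𝒜)
include h𝒜

theorem evalSeries_exp_sub_one {a : Conv K H} (ha : a ∈ filt 𝒜 1) :
    evalSeries 𝒜 a (PowerSeries.exp K - 1) = exp 𝒜 a - 1 := by
  rw [exp_eq_evalSeries]
  exact (map_sub (evalSeriesHom h𝒜 ha) _ _).trans (congrArg _ (map_one (evalSeriesHom h𝒜 ha)))

theorem exp_sub_one_mem {a : Conv K H} (ha : a ∈ filt 𝒜 1) : exp 𝒜 a - 1 ∈ filt 𝒜 1 := by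
  rw [← evalSeries_exp_sub_one h𝒜 ha]
  exact evalSeries_mem_filt h𝒜 ha (by simp [PowerSeries.X_dvd_iff])

theorem log_mem {b : Conv K H} (hb : b - 1 ∈ filt 𝒜 1) : log 𝒜 b ∈ filt 𝒜 1 := by
  rw [log_eq_evalSeries]
  exact evalSeries_mem_filt h𝒜 hb (by simp [PowerSeries.X_dvd_iff])

theorem log_exp {a : Conv K H} (ha : a ∈ filt 𝒜 1) : log 𝒜 (exp 𝒜 a) = a := by
  rw [log_eq_evalSeries, ← evalSeries_exp_sub_one h𝒜 ha, evalSeries_subst h𝒜 ha _ (by simp),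
    log_subst_exp_sub_one, evalSeries_X]

theorem exp_log {b : Conv K H} (hb : b - 1 ∈ filt 𝒜 1) : exp 𝒜 (log 𝒜 b) = b := by
  have h := evalSeries_exp_sub_one h𝒜 (log_mem h𝒜 hb)
  rw [log_eq_evalSeries, evalSeries_subst h𝒜 hb _ (by simp), exp_sub_one_subst_log,
    evalSeries_X, ← log_eq_evalSeries] at h
  exact (sub_left_injective h).symm

theorem exp_smul_mul_exp_smul {a : Conv K H} (ha : a ∈ filt 𝒜 1) (c d : K) :
    exp 𝒜 (c • a) * exp 𝒜 (d • a) = exp 𝒜 ((c + d) • a) := by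
  simp only [exp_eq_evalSeries, ← evalSeries_rescale h𝒜 ha]
  rw [← evalSeries_mul h𝒜 ha, PowerSeries.exp_mul_exp_eq_exp_add]

theorem exp_zero : exp 𝒜 (0 : Conv K H) = 1 := by
  have h0 := Submodule.zero_mem (filt 𝒜 1)
  have h := exp_log h𝒜 (b := 1) (by rw [sub_self]; exact h0)
  have hl : log 𝒜 (1 : Conv K H) = 0 := by
    rw [log_eq_evalSeries, sub_self]
    refine eq_of_forall_sub_mem_filt 𝒜 fun N => ?_
    have hN := evalSeries_sub_aeval_mem h𝒜 h0 (PowerSeries.log K) N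
    rcases N with _ | N
    · exact mem_filt_zero 𝒜 _
    · simpa [Polynomial.aeval_def, PowerSeries.eval₂_trunc_eq_sum_range,
        Finset.sum_range_succ'] using hN
  rwa [hl] at h

theorem exp_neg_mul_exp {a : Conv K H} (ha : a ∈ filt 𝒜 1) : exp 𝒜 (-a) * exp 𝒜 a = 1 := by
  have h := exp_smul_mul_exp_smul h𝒜 ha (-1) 1
  rwa [neg_one_smul, one_smul, neg_add_cancel, zero_smul, exp_zero h𝒜] at h

theorem exp_mul_exp_neg {a : Conv K H} (ha : a ∈ filt 𝒜 1) : exp 𝒜 a * exp 𝒜 (-a) = 1 := by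
  simpa using exp_neg_mul_exp h𝒜 (Submodule.neg_mem _ ha)

theorem exp_mul_exp_sub_one_mem {x y : Conv K H} (hx : x ∈ filt 𝒜 1) (hy : y ∈ filt 𝒜 1) :
    exp 𝒜 x * exp 𝒜 y - 1 ∈ filt 𝒜 1 := by
  convert Submodule.add_mem _ (mul_right_mem_filt h𝒜 (exp_sub_one_mem h𝒜 hx) (exp 𝒜 y))
    (exp_sub_one_mem h𝒜 hy) using 1
  simp only [sub_mul, one_mul]
  abel

theorem BCH_mem {x y : Conv K H} (hx : x ∈ filt 𝒜 1) (hy : y ∈ filt 𝒜 1) :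
    BCH 𝒜 x y ∈ filt 𝒜 1 :=
  Submodule.sub_mem _ (Submodule.sub_mem _ (log_mem h𝒜 (exp_mul_exp_sub_one_mem h𝒜 hx hy)) hx) hy

theorem exp_add_BCH {x y : Conv K H} (hx : x ∈ filt 𝒜 1) (hy : y ∈ filt 𝒜 1) :
    exp 𝒜 (x + y + BCH 𝒜 x y) = exp 𝒜 x * exp 𝒜 y := by
  rw [BCH, show ∀ l : Conv K H, x + y + (l - x - y) = l by intro l; abel]
  exact exp_log h𝒜 (exp_mul_exp_sub_one_mem h𝒜 hx hy)

theorem BCH_eq_of_exp_eq {x y z : Conv K H} (hz : z ∈ filt 𝒜 1)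
    (h : exp 𝒜 x * exp 𝒜 y = exp 𝒜 z) : BCH 𝒜 x y = z - x - y := by
  rw [BCH, h, log_exp h𝒜 hz]

theorem exp_sub_exp_mem {x y : Conv K H} (hx : x ∈ filt 𝒜 1) (hy : y ∈ filt 𝒜 1) {n : ℕ}
    (h : x - y ∈ filt 𝒜 n) : exp 𝒜 x - exp 𝒜 y - (x - y) ∈ filt 𝒜 (n + 1) := by
  simpa [exp_eq_evalSeries, PowerSeries.coeff_exp] using
    evalSeries_sub_evalSeries_mem h𝒜 hx hy h (PowerSeries.exp K)

theorem log_sub_log_mem {b c : Conv K H} (hb : b - 1 ∈ filt 𝒜 1) (hc : c - 1 ∈ filt 𝒜 1) {n : ℕ}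
    (h : b - c ∈ filt 𝒜 n) : log 𝒜 b - log 𝒜 c - (b - c) ∈ filt 𝒜 (n + 1) := by
  simpa [log_eq_evalSeries, PowerSeries.coeff_log] using
    evalSeries_sub_evalSeries_mem h𝒜 hb hc (n := n) (by simpa using h) (PowerSeries.log K)

/-- The map `BCH` is contracting in both arguments. -/
theorem BCH_sub_BCH_mem {x y x' y' : Conv K H} (hx : x ∈ filt 𝒜 1) (hy : y ∈ filt 𝒜 1)
    (hx' : x' ∈ filt 𝒜 1) (hy' : y' ∈ filt 𝒜 1) {n : ℕ} (hxx : x - x' ∈ filt 𝒜 n)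
    (hyy : y - y' ∈ filt 𝒜 n) : BCH 𝒜 x y - BCH 𝒜 x' y' ∈ filt 𝒜 (n + 1) := by
  have ex := exp_sub_exp_mem h𝒜 hx hx' hxx
  have ey := exp_sub_exp_mem h𝒜 hy hy' hyy
  -- To first order the product varies like x + y, exactly what `BCH` subtracts.
  have e1 : exp 𝒜 x * exp 𝒜 y - exp 𝒜 x' * exp 𝒜 y' - (x - x') - (y - y') ∈ filt 𝒜 (n + 1) := by
    have i1 := mul_right_mem_filt h𝒜 ex (exp 𝒜 y)
    have i2 := mul_mem_filt 𝒜 h𝒜 hxx (exp_sub_one_mem h𝒜 hy)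
    have i3 := mul_left_mem_filt h𝒜 (exp 𝒜 x') ey
    have i4 := mul_mem_filt 𝒜 h𝒜 (exp_sub_one_mem h𝒜 hx') hyy
    rw [add_comm 1 n] at i4
    convert Submodule.add_mem _ (Submodule.add_mem _ i1 i2) (Submodule.add_mem _ i3 i4) using 1
    simp only [sub_mul, mul_sub, one_mul, mul_one]
    abel
  have e2 : exp 𝒜 x * exp 𝒜 y - exp 𝒜 x' * exp 𝒜 y' ∈ filt 𝒜 n := by
    convert Submodule.add_mem _ (Submodule.add_mem _ (filt_anti 𝒜 n.le_succ e1) hxx) hyy using 1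
    abel
  have e3 := log_sub_log_mem h𝒜 (exp_mul_exp_sub_one_mem h𝒜 hx hy)
    (exp_mul_exp_sub_one_mem h𝒜 hx' hy') e2
  convert Submodule.add_mem _ e3 e1 using 1
  simp only [BCH]
  abel

end ExpLog

/-! ### Convergence of the BCH-recursion, for any filtration-preserving P. -/

section Recursion

variable {K H : Type*} [Field K] [CharZero K] [Ring H] [HopfAlgebra K H]
variable {𝒜 : ℕ → Submodule K H} [GradedAlgebra 𝒜] (h𝒜 : IsConnectedGradedHopf 𝒜)
variable {P : Conv K H →ₗ[K] Conv K H} (hP : ∀ n, ∀ f ∈ filt 𝒜 n, P f ∈ filt 𝒜 n)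
include h𝒜 hP

theorem chiStep_sub_mem {f g : Conv K H} (hf : f ∈ filt 𝒜 1) (hg : g ∈ filt 𝒜 1) {n : ℕ}
    (hfg : f - g ∈ filt 𝒜 n) :
    BCH 𝒜 (P f) (f - P f) - BCH 𝒜 (P g) (g - P g) ∈ filt 𝒜 (n + 1) := by
  have h := hP n _ hfg
  refine BCH_sub_BCH_mem h𝒜 (hP 1 _ hf) (Submodule.sub_mem _ hf (hP 1 _ hf)) (hP 1 _ hg)
    (Submodule.sub_mem _ hg (hP 1 _ hg)) (by rwa [← map_sub]) ?_
  rw [sub_sub_sub_comm, ← map_sub]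
  exact Submodule.sub_mem _ hfg h

theorem chiSeq_mem {a : Conv K H} (ha : a ∈ filt 𝒜 1) (n : ℕ) : chiSeq 𝒜 P a n ∈ filt 𝒜 1 := by
  induction n with
  | zero => exact ha
  | succ n ih =>
    exact Submodule.sub_mem _ ha
      (BCH_mem h𝒜 (hP 1 _ ih) (Submodule.sub_mem _ ih (hP 1 _ ih)))

theorem chiSeq_succ_sub_mem {a : Conv K H} (ha : a ∈ filt 𝒜 1) (n : ℕ) :
    chiSeq 𝒜 P a (n + 1) - chiSeq 𝒜 P a n ∈ filt 𝒜 n := by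
  induction n with
  | zero => exact mem_filt_zero 𝒜 _
  | succ n ih =>
    have h := chiStep_sub_mem h𝒜 hP (chiSeq_mem h𝒜 hP ha (n + 1)) (chiSeq_mem h𝒜 hP ha n) ih
    rw [← Submodule.neg_mem_iff] at h
    convert h using 1
    simp only [chiSeq]
    abel

theorem filtTendsto_chi {a : Conv K H} (ha : a ∈ filt 𝒜 1) :
    FiltTendsto 𝒜 (chiSeq 𝒜 P a) (chi 𝒜 P a) :=
  filtTendsto_filtLim 𝒜 (chiSeq_succ_sub_mem h𝒜 hP ha)

theorem chi_mem {a : Conv K H} (ha : a ∈ filt 𝒜 1) : chi 𝒜 P a ∈ filt 𝒜 1 := by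
  obtain ⟨n, hn⟩ := (filtTendsto_chi h𝒜 hP ha 1).exists
  simpa using Submodule.sub_mem _ (chiSeq_mem h𝒜 hP ha n) hn

/-- The shifted sequence tends to the limit and, by contraction, also to the image of the limit
under one step. -/
theorem chi_eq {a : Conv K H} (ha : a ∈ filt 𝒜 1) :
    chi 𝒜 P a = a - BCH 𝒜 (P (chi 𝒜 P a)) (chi 𝒜 P a - P (chi 𝒜 P a)) := by
  have hlim := filtTendsto_chi h𝒜 hP ha
  refine filtTendsto_unique 𝒜 (u := fun n => chiSeq 𝒜 P a (n + 1))
    (fun N => (Filter.tendsto_add_atTop_nat 1).eventually (hlim N)) fun N => ?_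
  filter_upwards [hlim N] with n hn
  have h := chiStep_sub_mem h𝒜 hP (chiSeq_mem h𝒜 hP ha n) (chi_mem h𝒜 hP ha) hn
  rw [← Submodule.neg_mem_iff] at h
  convert filt_anti 𝒜 N.le_succ h using 1
  simp only [chiSeq]
  abel

theorem exp_mul_exp_chi {a : Conv K H} (ha : a ∈ filt 𝒜 1) :
    exp 𝒜 (P (chi 𝒜 P a)) * exp 𝒜 (chi 𝒜 P a - P (chi 𝒜 P a)) = exp 𝒜 a := by
  have hc := chi_mem h𝒜 hP ha
  rw [← exp_add_BCH h𝒜 (hP 1 _ hc) (Submodule.sub_mem _ hc (hP 1 _ hc)), add_sub_cancel]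
  exact congrArg _ (eq_sub_iff_add_eq.1 (chi_eq h𝒜 hP ha))

end Recursion

/-! ### The sign automorphism and the closed formulas. -/

section Parity

variable {K H : Type*} [Field K] [Ring H] [HopfAlgebra K H]
variable (𝒜 : ℕ → Submodule K H) [GradedAlgebra 𝒜]

theorem piMinus_apply (f : Conv K H) {n : ℕ} {h : H} (hh : h ∈ 𝒜 n) :
    piMinus 𝒜 f h = if Odd n then f h else 0 := by
  change f (oddProj 𝒜 h) = _
  rw [oddProj_apply 𝒜 hh]
  split_ifs <;> simp

theorem piMinus_mem_filt (n : ℕ) (f : Conv K H) (hf : f ∈ filt 𝒜 n) :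
    piMinus 𝒜 f ∈ filt 𝒜 n := by
  intro i hi h hh
  rw [piMinus_apply 𝒜 f hh, hf i hi h hh, ite_self]

theorem piMinus_piMinus (f : Conv K H) : piMinus 𝒜 (piMinus 𝒜 f) = piMinus 𝒜 f := by
  refine ext_homogeneous 𝒜 fun i a ha => ?_
  simp only [piMinus_apply 𝒜 _ ha]
  split_ifs <;> rfl

/-- The linear map `π₊ - π₋`, which multiplies the functionals on `H_n` by `(-1)ⁿ`. -/
noncomputable def gradeSign : Conv K H →ₗ[K] Conv K H :=
  LinearMap.id - (2 : K) • piMinus 𝒜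

theorem gradeSign_eq (f : Conv K H) : gradeSign 𝒜 f = f - (2 : K) • piMinus 𝒜 f := rfl

theorem gradeSign_apply (f : Conv K H) {n : ℕ} {h : H} (hh : h ∈ 𝒜 n) :
    gradeSign 𝒜 f h = (-1) ^ n * f h := by
  have h1 : gradeSign 𝒜 f h = f h - 2 * piMinus 𝒜 f h := by
    simp [gradeSign_eq]
  rw [h1, piMinus_apply 𝒜 f hh]
  split_ifs with hn
  · rw [hn.neg_one_pow]; ring
  · rw [(Nat.not_odd_iff_even.1 hn).neg_one_pow]; ring

theorem gradeSign_mem_filt {n : ℕ} {f : Conv K H} (hf : f ∈ filt 𝒜 n) :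
    gradeSign 𝒜 f ∈ filt 𝒜 n := by
  intro i hi h hh
  rw [gradeSign_apply 𝒜 f hh, hf i hi h hh, mul_zero]

variable {𝒜} (h𝒜 : IsConnectedGradedHopf 𝒜)
include h𝒜

theorem gradeSign_one : gradeSign 𝒜 (1 : Conv K H) = 1 := by
  refine ext_homogeneous 𝒜 fun i a ha => ?_
  rw [gradeSign_apply 𝒜 _ ha]
  rcases eq_or_ne i 0 with rfl | hi
  · simp
  · have : (1 : Conv K H) a = 0 := by
      simpa using h𝒜.counit_eq_zero i hi a ha
    rw [this, mul_zero]

theorem gradeSign_mul (f g : Conv K H) :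
    gradeSign 𝒜 (f * g) = gradeSign 𝒜 f * gradeSign 𝒜 g := by
  refine ext_homogeneous 𝒜 fun i a ha => ?_
  rw [gradeSign_apply 𝒜 _ ha, LinearMap.convMul_apply, LinearMap.convMul_apply]
  have key : (⨆ p ∈ Finset.HasAntidiagonal.antidiagonal i,
      LinearMap.range (TensorProduct.mapIncl (𝒜 p.1) (𝒜 p.2))) ≤
      LinearMap.ker ((-1 : K) ^ i • (LinearMap.mul' K K ∘ₗ TensorProduct.map f.ofConv g.ofConv) -
        LinearMap.mul' K K ∘ₗ TensorProduct.map (gradeSign 𝒜 f).ofConv (gradeSign 𝒜 g).ofConv) := by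
    refine iSup₂_le fun p hp => ?_
    rw [TensorProduct.range_mapIncl, Submodule.map₂_le]
    intro b hb c hc
    have hp' := Finset.HasAntidiagonal.mem_antidiagonal.mp hp
    simp only [LinearMap.mem_ker, LinearMap.sub_apply, LinearMap.smul_apply, LinearMap.comp_apply,
      TensorProduct.mk_apply, TensorProduct.map_tmul, LinearMap.mul'_apply, smul_eq_mul]
    rw [gradeSign_apply 𝒜 f hb, gradeSign_apply 𝒜 g hc, ← hp', pow_add]
    ring
  -- On 𝒜 p ⊗ 𝒜 q with p + q = i the signs multiply to (-1) ^ i.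
  have h := key (h𝒜.comul_mem i a ha)
  rwa [LinearMap.mem_ker, LinearMap.sub_apply, sub_eq_zero] at h

/-- The map `π₊ - π₋` as an endomorphism of the convolution algebra. -/
noncomputable def gradeSignHom : Conv K H →ₐ[K] Conv K H :=
  AlgHom.ofLinearMap (gradeSign 𝒜) (gradeSign_one h𝒜) (gradeSign_mul h𝒜)

theorem gradeSign_evalSeries {a : Conv K H} (ha : a ∈ filt 𝒜 1) (f : PowerSeries K) :
    gradeSign 𝒜 (evalSeries 𝒜 a f) = evalSeries 𝒜 (gradeSign 𝒜 a) f := by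
  refine (filtLim_eq 𝒜 fun N => ?_).symm
  filter_upwards [filtTendsto_evalSeries h𝒜 ha f N] with n hn
  have h := gradeSign_mem_filt 𝒜 hn
  rw [map_sub] at h
  convert h using 2
  exact Polynomial.aeval_algHom_apply (gradeSignHom h𝒜) a _

variable [CharZero K]

theorem gradeSign_exp {a : Conv K H} (ha : a ∈ filt 𝒜 1) :
    gradeSign 𝒜 (exp 𝒜 a) = exp 𝒜 (gradeSign 𝒜 a) := by
  rw [exp_eq_evalSeries, exp_eq_evalSeries, gradeSign_evalSeries h𝒜 ha]

theorem exp_mul_exp_neg_gradeSign {Z : Conv K H} (hZ : Z ∈ filt 𝒜 1) :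
    exp 𝒜 Z * exp 𝒜 (-gradeSign 𝒜 Z) =
      exp 𝒜 ((2 : K) • piMinus 𝒜 (chi 𝒜 (piMinus 𝒜) Z)) := by
  have hP := piMinus_mem_filt 𝒜
  have hc := chi_mem h𝒜 hP hZ
  have hm := hP 1 _ hc
  have hE := exp_mul_exp_chi h𝒜 hP hZ
  set c := chi 𝒜 (piMinus 𝒜) Z
  set m := piMinus 𝒜 c
  have hp : c - m ∈ filt 𝒜 1 := Submodule.sub_mem _ hc hm
  have sm : gradeSign 𝒜 m = -m := by
    rw [gradeSign_eq, piMinus_piMinus, two_smul]; abel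
  have sp : gradeSign 𝒜 (c - m) = c - m := by
    rw [gradeSign_eq, map_sub, piMinus_piMinus, sub_self, smul_zero, sub_zero]
  have hσ := congrArg (gradeSign 𝒜) hE
  rw [gradeSign_mul h𝒜, gradeSign_exp h𝒜 hm, gradeSign_exp h𝒜 hp, gradeSign_exp h𝒜 hZ, sm, sp]
    at hσ
  have hσZ := gradeSign_mem_filt 𝒜 hZ
  -- Inverse of exp(σZ) = exp(-m) ⋆ exp(c - m); the even factors then cancel against those of
  -- exp(Z).
  have hinv : exp 𝒜 (-gradeSign 𝒜 Z) = exp 𝒜 (-(c - m)) * exp 𝒜 m := by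
    refine left_inv_eq_right_inv (exp_neg_mul_exp h𝒜 hσZ) ?_
    rw [← hσ, mul_assoc, ← mul_assoc (exp 𝒜 (c - m)), exp_mul_exp_neg h𝒜 hp, one_mul,
      exp_neg_mul_exp h𝒜 hm]
  rw [hinv, ← hE, mul_assoc, ← mul_assoc (exp 𝒜 (c - m)), exp_mul_exp_neg h𝒜 hp, one_mul]
  have h2 := exp_smul_mul_exp_smul h𝒜 hm 1 1
  rwa [one_smul, one_add_one_eq_two] at h2

/-- The odd part of `χ(Z)`, for every `Z ∈ A_1`. -/
theorem piMinus_chi {Z : Conv K H} (hZ : Z ∈ filt 𝒜 1) :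
    piMinus 𝒜 (chi 𝒜 (piMinus 𝒜) Z) =
      piMinus 𝒜 Z + (2⁻¹ : K) • BCH 𝒜 Z ((2 : K) • piMinus 𝒜 Z - Z) := by
  have hm := piMinus_mem_filt 𝒜 1 _ (chi_mem h𝒜 (piMinus_mem_filt 𝒜) hZ)
  have h := BCH_eq_of_exp_eq h𝒜 (Submodule.smul_mem _ (2 : K) hm)
    (exp_mul_exp_neg_gradeSign h𝒜 hZ)
  -- Here -σZ becomes 2π₋(Z) - Z.
  rw [gradeSign_eq, neg_sub] at h
  rw [h, sub_sub, add_sub_cancel, smul_sub, smul_smul, smul_smul, inv_mul_cancel₀ two_ne_zero,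
    one_smul, one_smul, add_sub_cancel]

/-- Solving the factorization for its even factor gives c₊ = log(exp(-c₋) ⋆ exp(Z)); adding c₋
cancels the linear term -c₋. -/
theorem chi_piMinus {Z : Conv K H} (hZ : Z ∈ filt 𝒜 1) :
    chi 𝒜 (piMinus 𝒜) Z = Z + BCH 𝒜 (-piMinus 𝒜 (chi 𝒜 (piMinus 𝒜) Z)) Z := by
  have hP := piMinus_mem_filt 𝒜
  have hc := chi_mem h𝒜 hP hZ
  have hm := hP 1 _ hc
  have hE := exp_mul_exp_chi h𝒜 hP hZ
  rw [BCH_eq_of_exp_eq h𝒜 (Submodule.sub_mem _ hc hm)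
    (by rw [← hE, ← mul_assoc, exp_neg_mul_exp h𝒜 hm, one_mul])]
  abel

end Parity

end EvenOddBCH

theorem mainTheorem7 {K H : Type*} [Field K] [CharZero K] [Ring H] [HopfAlgebra K H]
    (𝒜 : ℕ → Submodule K H) [GradedAlgebra 𝒜] (h𝒜 : EvenOddBCH.IsConnectedGradedHopf 𝒜)
    (Z : EvenOddBCH.Conv K H) (hZ : Z ∈ EvenOddBCH.infinitesimalCharacters K H) :
    EvenOddBCH.FiltTendsto 𝒜 (EvenOddBCH.chiSeq 𝒜 (EvenOddBCH.piMinus 𝒜) Z)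
        (EvenOddBCH.chi 𝒜 (EvenOddBCH.piMinus 𝒜) Z) ∧
      EvenOddBCH.chi 𝒜 (EvenOddBCH.piMinus 𝒜) Z =
        Z + EvenOddBCH.BCH 𝒜
          (-EvenOddBCH.piMinus 𝒜 Z -
            (2⁻¹ : K) • EvenOddBCH.BCH 𝒜 Z ((2 : K) • EvenOddBCH.piMinus 𝒜 Z - Z)) Z ∧
      EvenOddBCH.piMinus 𝒜 (EvenOddBCH.chi 𝒜 (EvenOddBCH.piMinus 𝒜) Z) =
        EvenOddBCH.piMinus 𝒜 Z +
          (2⁻¹ : K) • EvenOddBCH.BCH 𝒜 Z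
            (EvenOddBCH.piMinus 𝒜 Z - EvenOddBCH.piPlus 𝒜 Z) := by
  have hZ1 := EvenOddBCH.infinitesimalCharacters_le 𝒜 h𝒜 hZ
  have hodd := EvenOddBCH.piMinus_chi h𝒜 hZ1
  refine ⟨EvenOddBCH.filtTendsto_chi h𝒜 (EvenOddBCH.piMinus_mem_filt 𝒜) hZ1, ?_, ?_⟩
  · rw [← neg_add', ← hodd]
    exact EvenOddBCH.chi_piMinus h𝒜 hZ1
  · rw [hodd, EvenOddBCH.piPlus, LinearMap.sub_apply, LinearMap.id_apply, two_smul,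
      sub_sub_eq_add_sub]
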